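/- Let $p\ge 1$ be an integer, let $d\ge 0$ be an integer, let $V$ be a finite set with $n$ elements, and let $G=(V,E)$ be a finite simple graph. For a configuration $r:V\to\mathbb{R}^d$, the length of a pair $\{v,w\}$ is $\|r(v)-r(w)\|_p$. The framework $(G,r)$ is well-positioned if the map sending a configuration to its vector of edge lengths is differentiable at $r$; its rigidity matrix is then the Jacobian matrix of this map at $r$, with $|E|$ rows and $d\,n$ columns. A well-positioned framework $(G,r)$ is regular if its rigidity matrix has the largest rank among all well-positioned frameworks of $G$ in $\mathbb{R}^d$. * $G$ is independent if the rigidity matrix of a well-positioned and regular framework of $G$ has linearly independent rows. * $G$ is rigid if the rank of the rigidity matrix of a well-positioned and regular framework of $G$ is maximal among the ranks of the rigidity matrices of all well-positioned frameworks in $\mathbb{R}^d$ of all graphs with vertex set $V$. * $G$ is maximal independent if it is independent and no independent graph with vertex set $V$ has more edges. * $G$ is minimally rigid if it is rigid and deleting any single edge gives a graph that is not rigid. Let $\Phi_{n,l_p}^d\subseteq\mathbb{R}^{\binom n2}$, the $d$-dimensional stratum of the cone of $l_p^p$-distance vectors, be the set of all vectors $\big(\|r(v)-r(w)\|_p^p\big)_{\{v,w\}}$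 with $r:V\to\mathbb{R}^d$, and let $\Phi_{G,l_p}^d\subseteq\mathbb{R}^{E}$ be its coordinate projection onto the edges of $G$. Let $\dim$ denote Hausdorff dimension (which is the usual dimension for these semialgebraic sets). Then: 1. $G$ is independent if and only if $\dim \Phi_{G,l_p}^d=|E|$. 2. $G$ is maximal independent if and only if $\dim \Phi_{G,l_p}^d=\dim\Phi_{n,l_p}^d$ and $\dim \Phi_{G,l_p}^d=|E|$; and $G$ is minimally rigid if and only if these same two equalities hold. 3. $G$ is rigid if and only if $\dim \Phi_{G,l_p}^d=\dim\Phi_{n,l_p}^d$. 4. $G$ is neither independent nor rigid if and only if $\dim \Phi_{G,l_p}^d<\min\{\dim\Phi_{n,l_p}^d,\,|E|\}$. -/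

import Mathlib

open scoped ENNReal

namespace LpRigidity

/-- The space `ℝ^d` with the `l_p` norm, `p` an integer. -/
abbrev LpSpace (p d : ℕ) : Type := PiLp (p : ℝ≥0∞) (fun _ : Fin d => ℝ)

section Frameworks

variable {V : Type*} {p d : ℕ} [Fact (1 ≤ (p : ℝ≥0∞))]

/-- The `l_p` distance between the two ends of an unordered pair, in the point configuration `r`. -/
noncomputable def pairLength (r : V → LpSpace p d) (e : Sym2 V) : ℝ :=
  Sym2.lift ⟨fun v w => dist (r v) (r w), fun v w => dist_comm (r v) (r w)⟩ e

variable (p d V) in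
/-- The `d`-dimensional stratum of the cone of `l_p^p` distance vectors: the vectors of pairwise
distances to the power `p`, one coordinate for each pair of distinct points (edge of the complete
graph), over all configurations of points in `d`-dimensional `l_p` space indexed by `V`. -/
def stratum : Set ((⊤ : SimpleGraph V).edgeSet → ℝ) :=
  Set.range fun (r : V → LpSpace p d) e => pairLength r (e : Sym2 V) ^ p

/-- The coordinate projection, from vectors indexed by all pairs to vectors indexed by the edges
of `G`. -/
def edgeProj (G : SimpleGraph V) (δ : (⊤ : SimpleGraph V).edgeSet → ℝ) : G.edgeSet → ℝ :=
  fun e => δ ⟨e, SimpleGraph.edgeSet_mono le_top e.2⟩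

variable (p d) in
/-- The coordinate projection of the `d`-dimensional stratum onto the edges of `G`. -/
def projStratum (G : SimpleGraph V) : Set (G.edgeSet → ℝ) :=
  edgeProj G '' stratum V p d

variable [Fintype V]

/-- The framework `(G, r)` is well-positioned: the lengths of the edges of `G` are differentiable
functions of the configuration at `r`. -/
def IsWellPositioned (G : SimpleGraph V) (r : V → LpSpace p d) : Prop :=
  ∀ e ∈ G.edgeSet,
    DifferentiableAt ℝ (fun s : V → LpSpace p d => pairLength s e) r

open Classical in
/-- The rigidity matrix of the framework `(G, r)`: the Jacobian matrix at `r` of the map that sends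
a configuration to the vector of edge lengths. It has one row for each edge and `d` columns for each
vertex; it is meaningful when the framework is well-positioned. -/
noncomputable def rigidityMatrix (G : SimpleGraph V) (r : V → LpSpace p d) :
    Matrix G.edgeSet (V × Fin d) ℝ :=
  Matrix.of fun e c =>
    fderiv ℝ (fun s : V → LpSpace p d => pairLength s (e : Sym2 V)) r
      (Pi.single c.1 (WithLp.toLp (p : ℝ≥0∞) (Pi.single c.2 (1 : ℝ))))

/-- The framework `(G, r)` is well-positioned and regular: its rigidity matrix has the largest rank
among all well-positioned frameworks of `G`. -/
def IsRegular (G : SimpleGraph V) (r : V → LpSpace p d) : Prop :=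
  IsWellPositioned G r ∧ ∀ s : V → LpSpace p d, IsWellPositioned G s →
    (rigidityMatrix G s).rank ≤ (rigidityMatrix G r).rank

variable (p d)

/-- `G` is independent: the rigidity matrix of a well-positioned and regular framework of `G` has
linearly independent rows. -/
def IsIndependent (G : SimpleGraph V) : Prop :=
  ∃ r : V → LpSpace p d, IsRegular G r ∧ LinearIndependent ℝ (rigidityMatrix G r).row

/-- `G` is rigid: the rank of the rigidity matrix of a well-positioned and regular framework of `G`
is maximal, among the frameworks of all graphs with the same vertices. -/
def IsRigid (G : SimpleGraph V) : Prop :=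
  ∃ r : V → LpSpace p d, IsRegular G r ∧
    ∀ (H : SimpleGraph V) (s : V → LpSpace p d), IsWellPositioned H s →
      (rigidityMatrix H s).rank ≤ (rigidityMatrix G r).rank

/-- `G` is maximal independent: it is independent, and no independent graph with the same vertices
has more edges. -/
def IsMaximalIndependent (G : SimpleGraph V) : Prop :=
  IsIndependent p d G ∧ ∀ H : SimpleGraph V, IsIndependent p d H →
    Nat.card H.edgeSet ≤ Nat.card G.edgeSet

/-- `G` is minimally rigid: it is rigid, and the removal of any edge makes it non-rigid. -/
def IsMinimallyRigid (G : SimpleGraph V) : Prop :=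
  IsRigid p d G ∧ ∀ e ∈ G.edgeSet, ¬ IsRigid p d (G.deleteEdges {e})

end Frameworks

/-- The dimension of a subset of a finite-dimensional real coordinate space: its Hausdorff
dimension. (The sets it is applied to are semialgebraic, and on these it is the usual dimension.) -/
noncomputable def dimension {ι : Type*} [Finite ι] (S : Set (ι → ℝ)) : ℝ≥0∞ :=
  letI : Fintype ι := Fintype.ofFinite ι
  dimH S

end LpRigidity

/-! Everything follows from one identity, `IsRegular.dimension_eq_rank`: the dimension of the
projected stratum is the largest rank of a rigidity matrix over the well-positioned frameworks of
`G`.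

Lower bound (`rank_le_dimension`): independent rows stay independent when lengths are replaced by
their `p`-th powers, since each differential is multiplied by a nonzero factor. The corresponding
measurements form a submersion, so their values fill a neighbourhood, and coordinate projections do
not raise dimension.

Upper bound (`dimension_projStratum_le`): once every coordinate is ordered along `V`, the `p`-th
powers of the lengths are polynomials. The projected stratum therefore lies in finitely many images
of polynomial maps. Such an image has dimension at most the transcendence degree of its components
(`dimH_range_eval_le`), and algebraically independent polynomials have independent differentials
somewhere in the open chamber (`exists_linearIndependent_polyDeriv`), which yields a framework of
that rank. Both facts rest on simple algebraic relations in characteristic zero.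

The four statements then compare ranks with edge counts, using that every graph has an independent
subgraph of the same dimension. -/

namespace LpRigidity

/-! ### Simple algebraic relations in characteristic zero. -/

section SeparableRelation

variable {k A B : Type*} [Field k] [CommRing A] [Algebra k A]

open MvPolynomial in
/-- A univariate polynomial with coefficients in `adjoin k (range a)` lifts to a polynomial in the
variables `B` and one more, compatibly with evaluation and with the derivative in the last
variable. -/
theorem exists_mvPolynomial_lift (a : B → A) (y : A)
    (f : Polynomial (Algebra.adjoin k (Set.range a))) :
    ∃ q : MvPolynomial (Option B) k,
      aeval (fun o : Option B => o.elim y a) q = Polynomial.aeval y f ∧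
      aeval (fun o : Option B => o.elim y a) (pderiv none q) =
        Polynomial.aeval y (Polynomial.derivative f) := by
  classical
  induction f using Polynomial.induction_on' with
  | add f g hf hg =>
    obtain ⟨q, hq, hq'⟩ := hf
    obtain ⟨r, hr, hr'⟩ := hg
    exact ⟨q + r, by simp [hq, hr], by simp [hq', hr']⟩
  | monomial n c =>
    obtain ⟨c, hc⟩ := c
    have hc' := hc
    rw [Algebra.adjoin_range_eq_range_aeval] at hc'
    obtain ⟨m, hm⟩ := hc'
    have hm' : aeval a m = c := hm
    have hd : pderiv none (rename some m : MvPolynomial (Option B) k) = 0 := by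
      apply pderiv_eq_zero_of_notMem_vars
      intro h
      have := vars_rename some m h
      simp at this
    have he : aeval (fun o : Option B => o.elim y a) (rename some m) = c := by
      rw [aeval_rename, ← hm']; rfl
    refine ⟨rename some m * X none ^ n, ?_, ?_⟩
    · rw [Polynomial.aeval_monomial]
      simp only [map_mul, map_pow, aeval_X, Option.elim_none, he]
      rfl
    · rw [Polynomial.derivative_monomial, Polynomial.aeval_monomial, Derivation.leibniz, hd]
      simp only [smul_eq_mul, pderiv_pow, pderiv_X_self, mul_one]
      rw [map_mul, mul_zero, add_zero, map_mul, he, map_mul, map_natCast, map_pow, map_natCast, aeval_X, ← mul_assoc]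
      rfl

open MvPolynomial in
/-- In characteristic zero, an element algebraic over `adjoin k (range a)` is a simple root of a
polynomial relation over `a`. -/
theorem exists_separable_relation [CharZero k] [IsDomain A] (a : B → A) (y : A)
    (h : IsAlgebraic (Algebra.adjoin k (Set.range a)) y) :
    ∃ q : MvPolynomial (Option B) k,
      aeval (fun o : Option B => o.elim y a) q = 0 ∧
      aeval (fun o : Option B => o.elim y a) (pderiv none q) ≠ 0 := by
  classical
  -- A nonzero annihilating polynomial of least degree has `y` as a simple root: in characteristic
  -- zero its derivative is nonzero of smaller degree.
  have hex : ∃ n, ∃ f : Polynomial (Algebra.adjoin k (Set.range a)),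
      f ≠ 0 ∧ Polynomial.aeval y f = 0 ∧ f.natDegree = n := by
    obtain ⟨f, hf, hf'⟩ := h
    exact ⟨_, f, hf, hf', rfl⟩
  obtain ⟨f, hf, hfy, hfn⟩ := Nat.find_spec hex
  have : CharZero A := charZero_of_injective_algebraMap (algebraMap k A).injective
  have hne : Polynomial.aeval y (Polynomial.derivative f) ≠ 0 := by
    intro h0
    have hdeg : f.natDegree ≠ 0 := by
      intro hd
      rw [Polynomial.eq_C_of_natDegree_eq_zero hd] at hfy hf
      rw [Polynomial.aeval_C] at hfy
      apply hf
      have : f.coeff 0 = 0 := Subtype.ext hfy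
      rw [this, map_zero]
    have hlt := Polynomial.natDegree_derivative_lt hdeg
    have hd0 : Polynomial.derivative f ≠ 0 := fun h1 =>
      hdeg (Polynomial.derivative_eq_zero.1 h1)
    exact Nat.find_min hex (hfn ▸ hlt) ⟨_, hd0, h0, rfl⟩
  obtain ⟨q, hq, hq'⟩ := exists_mvPolynomial_lift a y f
  exact ⟨q, hq.trans hfy, hq' ▸ hne⟩

end SeparableRelation

/-! ### Differentials of polynomials and the Jacobian criterion. -/

section Gradient

variable {σ : Type*} [Fintype σ]

/-- The differential at `x` of the function defined by a polynomial. -/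
noncomputable def polyDeriv (q : MvPolynomial σ ℝ) (x : σ → ℝ) : (σ → ℝ) →L[ℝ] ℝ :=
  ∑ i, MvPolynomial.eval x (MvPolynomial.pderiv i q) • ContinuousLinearMap.proj i

theorem polyDeriv_apply (q : MvPolynomial σ ℝ) (x v : σ → ℝ) :
    polyDeriv q x v = ∑ i, MvPolynomial.eval x (MvPolynomial.pderiv i q) * v i := by
  simp [polyDeriv]

open MvPolynomial in
theorem polyDeriv_X (i : σ) (x : σ → ℝ) :
    polyDeriv (X i : MvPolynomial σ ℝ) x = ContinuousLinearMap.proj i := by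
  classical
  ext v
  rw [polyDeriv_apply, Finset.sum_eq_single i]
  · simp
  · intro j _ hj
    rw [pderiv_X_of_ne hj.symm]; simp
  · simp

theorem polyDeriv_zero (x : σ → ℝ) : polyDeriv (0 : MvPolynomial σ ℝ) x = 0 := by
  simp [polyDeriv]

open MvPolynomial in
theorem hasStrictFDerivAt_eval (q : MvPolynomial σ ℝ) (x : σ → ℝ) :
    HasStrictFDerivAt (fun y : σ → ℝ => eval y q) (polyDeriv q x) x := by
  classical
  induction q using MvPolynomial.induction_on with
  | C c =>
    have : polyDeriv (C c : MvPolynomial σ ℝ) x = 0 := by simp [polyDeriv]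
    rw [this]
    simpa using hasStrictFDerivAt_const c x
  | add p q hp hq =>
    have : polyDeriv (p + q) x = polyDeriv p x + polyDeriv q x := by
      ext v; simp [polyDeriv_apply, add_mul, Finset.sum_add_distrib]
    rw [this]
    exact (hp.add hq).congr_of_eventuallyEq (Filter.Eventually.of_forall fun y => by simp)
  | mul_X p i hp =>
    have hX : HasStrictFDerivAt (fun y : σ → ℝ => y i)
        (ContinuousLinearMap.proj i : (σ → ℝ) →L[ℝ] ℝ) x :=
      (ContinuousLinearMap.proj i : (σ → ℝ) →L[ℝ] ℝ).hasStrictFDerivAt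
    have : polyDeriv (p * X i) x =
        eval x p • (ContinuousLinearMap.proj i : (σ → ℝ) →L[ℝ] ℝ) + x i • polyDeriv p x := by
      rw [← polyDeriv_X i x]
      ext v
      simp only [polyDeriv_apply, Derivation.leibniz, smul_eq_mul, map_add, map_mul, eval_X,
        add_mul, Finset.sum_add_distrib, add_apply,
        smul_apply, Finset.mul_sum, mul_assoc]
    rw [this]
    exact (hp.mul hX).congr_of_eventuallyEq (Filter.Eventually.of_forall fun y => by simp)

open MvPolynomial in
/-- The chain rule. -/
theorem polyDeriv_aeval {τ : Type*} [Fintype τ] (a : τ → MvPolynomial σ ℝ)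
    (q : MvPolynomial τ ℝ) (x : σ → ℝ) :
    polyDeriv (aeval a q) x = ∑ t, eval x (aeval a (pderiv t q)) • polyDeriv (a t) x := by
  have hev : ∀ (y : σ → ℝ) (m : MvPolynomial τ ℝ),
      eval y (aeval a m) = eval (fun t => eval y (a t)) m := by
    intro y m
    have : (aeval y : MvPolynomial σ ℝ →ₐ[ℝ] ℝ).comp (aeval a) =
        aeval (fun t => eval y (a t)) := by
      ext t; simp [aeval_eq_eval]
    have h2 := DFunLike.congr_fun this m
    simpa [aeval_eq_eval] using h2
  have h1 : HasFDerivAt (fun y => eval y (aeval a q)) (polyDeriv (aeval a q) x) x :=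
    (hasStrictFDerivAt_eval _ x).hasFDerivAt
  have h2 : HasFDerivAt (fun y => eval y (aeval a q))
      ((polyDeriv q (fun t => eval x (a t))).comp
        (ContinuousLinearMap.pi fun t => polyDeriv (a t) x)) x := by
    simp only [hev]
    exact ((hasStrictFDerivAt_eval q _).comp x
      (hasStrictFDerivAt_pi.2 fun t => hasStrictFDerivAt_eval (a t) x)).hasFDerivAt
  rw [h1.unique h2]
  ext v
  simp only [ContinuousLinearMap.comp_apply, polyDeriv_apply q, ContinuousLinearMap.pi_apply,
    sum_apply, smul_apply, smul_eq_mul, hev]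

open MvPolynomial in
/-- A nonzero polynomial does not vanish identically on a nonempty open set. -/
theorem exists_eval_ne_zero_of_isOpen {q : MvPolynomial σ ℝ} (hq : q ≠ 0) {U : Set (σ → ℝ)}
    (hU : IsOpen U) (hne : U.Nonempty) : ∃ x ∈ U, eval x q ≠ 0 := by
  by_contra! h
  obtain ⟨x, hx⟩ := hne
  obtain ⟨ε, hε, hb⟩ := Metric.isOpen_iff.1 hU x hx
  -- A ball in the sup norm is a product of intervals, and a polynomial vanishing on a product of
  -- infinite sets is zero.
  refine hq (funext_set (fun i => Metric.ball (x i) ε) (fun i => ?_) fun y hy => ?_)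
  · rw [Real.ball_eq_Ioo]
    exact Set.Ioo_infinite (by linarith)
  · rw [map_zero]
    refine h y (hb ?_)
    rw [ball_pi x hε]
    exact hy

open MvPolynomial in
/-- The Jacobian criterion: algebraically independent real polynomials have linearly independent
differentials at some point of any nonempty open set. -/
theorem exists_linearIndependent_polyDeriv {ι : Type*} {F : ι → MvPolynomial σ ℝ}
    (hF : AlgebraicIndependent ℝ F) {U : Set (σ → ℝ)} (hU : IsOpen U) (hne : U.Nonempty) :
    ∃ x ∈ U, LinearIndependent ℝ fun i => polyDeriv (F i) x := by
  classical
  have halg : Algebra.IsAlgebraic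
      (Algebra.adjoin ℝ (Set.range F ∪ Set.range (X : σ → MvPolynomial σ ℝ)))
      (MvPolynomial σ ℝ) := by
    refine ⟨fun q => ?_⟩
    have hq : q ∈ Algebra.adjoin ℝ (Set.range F ∪ Set.range (X : σ → MvPolynomial σ ℝ)) :=
      Algebra.adjoin_mono Set.subset_union_right (by rw [adjoin_range_X]; trivial)
    exact isAlgebraic_algebraMap
      (⟨q, hq⟩ : Algebra.adjoin ℝ (Set.range F ∪ Set.range (X : σ → MvPolynomial σ ℝ)))
  -- `F` is completed by variables to a transcendence basis, which has as many elements as there are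
  -- variables.
  obtain ⟨T, hFT, -, hT⟩ := exists_isTranscendenceBasis_between (R := ℝ) (Set.range F) _
    (Set.subset_union_left (t := Set.range (X : σ → MvPolynomial σ ℝ)))
    hF.to_subtype_range
  have hcard := hT.lift_cardinalMk_eq (IsTranscendenceBasis.mvPolynomial σ ℝ)
  have hfin : Finite T := by
    rw [← Cardinal.mk_lt_aleph0_iff, ← Cardinal.lift_lt_aleph0, hcard, Cardinal.lift_lt_aleph0]
    exact Cardinal.mk_lt_aleph0
  have : Fintype T := Fintype.ofFinite T
  have hcard' : Fintype.card T = Fintype.card σ := by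
    simpa [Cardinal.mk_fintype] using hcard
  have hTalg := hT.isAlgebraic
  choose q hq hq' using fun s : σ => exists_separable_relation (k := ℝ)
    (Subtype.val : T → MvPolynomial σ ℝ) (X s) (hTalg.isAlgebraic (X s))
  obtain ⟨x, hxU, hx⟩ := exists_eval_ne_zero_of_isOpen
    (Finset.prod_ne_zero_iff.2 fun s (_ : s ∈ Finset.univ) => hq' s) hU hne
  rw [map_prod] at hx
  have hx := fun s => Finset.prod_ne_zero_iff.1 hx s (Finset.mem_univ s)
  have hmem : ∀ s : σ, (ContinuousLinearMap.proj s : (σ → ℝ) →L[ℝ] ℝ) ∈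
      Submodule.span ℝ (Set.range fun t : T => polyDeriv (t : MvPolynomial σ ℝ) x) := by
    intro s
    -- Differentiating the relation satisfied by `X s` and dividing by its nonzero partial
    -- derivative puts the coordinate form in the span of the differentials of `T`. These then span
    -- the dual, and by their number form a basis.
    have h := polyDeriv_aeval (fun o : Option T => o.elim (X s) Subtype.val) (q s) x
    rw [hq s, polyDeriv_zero, Fintype.sum_option] at h
    simp only [Option.elim_none, Option.elim_some, polyDeriv_X] at h
    rw [← Submodule.smul_mem_iff _ (hx s), eq_neg_of_add_eq_zero_left h.symm]
    exact Submodule.neg_mem _ (Submodule.sum_mem _ fun t _ => Submodule.smul_mem _ _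
      (Submodule.subset_span ⟨t, rfl⟩))
  have htop : ⊤ ≤ Submodule.span ℝ
      (Set.range fun t : T => polyDeriv (t : MvPolynomial σ ℝ) x) := by
    intro l _
    have : l = ∑ s, l (Pi.single s 1) • (ContinuousLinearMap.proj s : (σ → ℝ) →L[ℝ] ℝ) := by
      ext v
      conv_lhs => rw [pi_eq_sum_univ' v]
      simp [mul_comm, Pi.single]
    rw [this]
    exact Submodule.sum_mem _ fun s _ => Submodule.smul_mem _ _ (hmem s)
  have hfr : Module.finrank ℝ ((σ → ℝ) →L[ℝ] ℝ) = Fintype.card σ := by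
    rw [← (LinearMap.toContinuousLinearMap : ((σ → ℝ) →ₗ[ℝ] ℝ) ≃ₗ[ℝ] _).finrank_eq]
    rw [Module.finrank_linearMap]; simp
  have hli := linearIndependent_of_top_le_span_of_card_eq_finrank htop (hcard'.trans hfr.symm)
  refine ⟨x, hxU, hli.comp (fun i => ⟨F i, hFT ⟨i, rfl⟩⟩) fun i j hij => ?_⟩
  exact hF.injective (congrArg Subtype.val hij)

end Gradient

end LpRigidity

namespace LpRigidity

/-! ### Hausdorff dimension of real zero sets and polynomial images. -/

section AlgebraicSets

variable {ι : Type*}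

/-- A set that is mapped into a set of dimension at most `k` by a map which has, at each of its
points, an invertible strict derivative has itself dimension at most `k`. -/
theorem dimH_le_of_hasStrictFDerivAt {E F : Type*} [NormedAddCommGroup E] [NormedSpace ℝ E]
    [NormedAddCommGroup F] [NormedSpace ℝ F] [SecondCountableTopology E] {f : E → F}
    {S : Set E} {T : Set F} (hST : Set.MapsTo f S T)
    (hf : ∀ x ∈ S, ∃ f' : E ≃L[ℝ] F, HasStrictFDerivAt f (f' : E →L[ℝ] F) x) :
    dimH S ≤ dimH T := by
  have hloc : ∀ x ∈ S, ∃ U ∈ nhdsWithin x S, dimH U ≤ dimH T := by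
    intro x hx
    obtain ⟨f', hf'⟩ := hf x hx
    obtain ⟨U, hxU, hUo, hU⟩ := hf'.approximates_deriv_on_open_nhds
    -- Strict differentiability with invertible derivative makes `f` antilipschitz near `x`, so it
    -- cannot lower dimension there; Hausdorff dimension is local.
    have hanti : ∃ K, AntilipschitzWith K (U.domRestrict f) := by
      rcases subsingleton_or_nontrivial E with h | h
      · exact ⟨_, hU.antilipschitz (Or.inl h)⟩
      · refine ⟨_, hU.antilipschitz (Or.inr ?_)⟩
        have : 0 < ‖(f'.symm : F →L[ℝ] E)‖₊⁻¹ := inv_pos.2 f'.nnnorm_symm_pos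
        exact NNReal.half_lt_self this.ne'
    obtain ⟨K, hK⟩ := hanti
    refine ⟨S ∩ U, Filter.inter_mem self_mem_nhdsWithin
      (mem_nhdsWithin_of_mem_nhds (hUo.mem_nhds hxU)), ?_⟩
    have h1 : dimH (S ∩ U) = dimH ((Subtype.val : U → E) ⁻¹' S) := by
      rw [← (isometry_subtype_coe (s := U)).dimH_image, Subtype.image_preimage_coe, Set.inter_comm]
    rw [h1]
    refine (hK.le_dimH_image _).trans (dimH_mono ?_)
    rintro _ ⟨y, hy, rfl⟩
    exact hST hy
  by_contra! h
  obtain ⟨x, hx, hlt⟩ := exists_mem_nhdsWithin_lt_dimH_of_lt_dimH h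
  obtain ⟨U, hU, hle⟩ := hloc x hx
  exact absurd (hlt U hU) (not_lt.2 hle)

open Classical in
/-- The coordinate subspace of vectors supported on the range of `s`. -/
theorem dimH_support_subset_range_le [Fintype ι] {B : Type*} [Fintype B] (s : B → ι) :
    dimH {z : ι → ℝ | ∀ i ∉ Set.range s, z i = 0} ≤ Fintype.card B := by
  let L : (B → ℝ) → ι → ℝ := fun w i => if h : ∃ b, s b = i then w h.choose else 0
  have hL : ContDiff ℝ 1 L := by
    refine contDiff_pi.2 fun i => ?_
    by_cases h : ∃ b, s b = i
    · simp only [L, dif_pos h]; exact contDiff_apply _ _ _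
    · simp only [L, dif_neg h]; exact contDiff_const
  have := hL.dimH_range_le
  rw [Module.finrank_fintype_fun_eq_card] at this
  refine (dimH_mono ?_).trans this
  intro z hz
  refine ⟨fun b => z (s b), funext fun i => ?_⟩
  by_cases h : ∃ b, s b = i
  · simp only [L, dif_pos h]; rw [h.choose_spec]
  · simp only [L, dif_neg h]; exact (hz i h).symm

/-- The real zeros of an ideal of polynomials. -/
def realZeros (I : Ideal (MvPolynomial ι ℝ)) : Set (ι → ℝ) :=
  {y | ∀ q ∈ I, MvPolynomial.eval y q = 0}

/-- Evaluation at a zero of `I` has a prime kernel containing `I`, hence containing a minimal prime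
over `I`. -/
theorem realZeros_subset_biUnion_minimalPrimes (I : Ideal (MvPolynomial ι ℝ)) :
    realZeros I ⊆ ⋃ Q ∈ I.minimalPrimes, realZeros Q := by
  intro y hy
  have hprime : (RingHom.ker (MvPolynomial.eval y)).IsPrime := RingHom.ker_isPrime _
  obtain ⟨Q, hQ, hle⟩ := Ideal.exists_minimalPrimes_le
    (I := I) (J := RingHom.ker (MvPolynomial.eval y)) fun q hq => hy q hq
  exact Set.mem_biUnion hQ fun q hq => hle hq

open MvPolynomial in
/-- Away from the zeros of one polynomial outside the prime `P`, the zeros of `P` have dimension at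
most the size of a set of algebraically independent coordinates modulo `P`. -/
theorem exists_dimH_realZeros_inter_le [Fintype ι] (P : Ideal (MvPolynomial ι ℝ)) [P.IsPrime] :
    ∃ (B : Set ι) (D : MvPolynomial ι ℝ),
      AlgebraicIndependent ℝ (fun b : B => Ideal.Quotient.mkₐ ℝ P (X (b : ι))) ∧ D ∉ P ∧
      dimH (realZeros P ∩ {y | eval y D ≠ 0}) ≤ (B.ncard : ℝ≥0∞) := by
  classical
  let φ := Ideal.Quotient.mkₐ ℝ P
  have hφ : Function.Surjective φ := Ideal.Quotient.mkₐ_surjective ℝ P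
  have hadj : Algebra.adjoin ℝ (Set.range fun i : ι => φ (X i)) = ⊤ := by
    have : (Set.range fun i : ι => φ (X i)) = φ '' Set.range X := by
      rw [← Set.range_comp]; rfl
    rw [this, ← AlgHom.map_adjoin, adjoin_range_X, Algebra.map_top,
      AlgHom.range_eq_top]
    exact hφ
  have halg : Algebra.IsAlgebraic (Algebra.adjoin ℝ (Set.range fun i : ι => φ (X i)))
      (MvPolynomial ι ℝ ⧸ P) := by
    refine ⟨fun a => ?_⟩
    have ha : a ∈ Algebra.adjoin ℝ (Set.range fun i : ι => φ (X i)) := by rw [hadj]; trivial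
    exact isAlgebraic_algebraMap
      (⟨a, ha⟩ : Algebra.adjoin ℝ (Set.range fun i : ι => φ (X i)))
  have := (faithfulSMul_iff_algebraMap_injective ℝ (MvPolynomial ι ℝ ⧸ P)).2
    (algebraMap ℝ (MvPolynomial ι ℝ ⧸ P)).injective
  obtain ⟨T, hTs, hT⟩ := exists_isTranscendenceBasis_subset (R := ℝ)
    (Set.range fun i : ι => φ (X i))
  choose s hs using fun t : T => hTs t.2
  have hsinj : Function.Injective s := fun t t' h => Subtype.ext ((hs t).symm.trans (h ▸ hs t'))
  have : Fintype T := Fintype.ofInjective s hsinj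
  have hTalg := hT.isAlgebraic
  choose q hq hq' using fun j : ι => exists_separable_relation (k := ℝ)
    (Subtype.val : T → MvPolynomial ι ℝ ⧸ P) (φ (X j)) (hTalg.isAlgebraic (φ (X j)))
  let a : ι → Option T → MvPolynomial ι ℝ := fun j o => o.elim (X j) fun t => X (s t)
  have haφ : ∀ (j : ι) (m : MvPolynomial (Option T) ℝ),
      φ (aeval (a j) m) = aeval (fun o : Option T => o.elim (φ (X j)) Subtype.val) m := by
    intro j m
    have : φ.comp (aeval (a j)) = aeval (fun o : Option T => o.elim (φ (X j)) Subtype.val) := by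
      ext o
      cases o with
      | none => simp [a]
      | some t => simpa [a] using hs t
    exact DFunLike.congr_fun this m
  have hmem : ∀ m, φ m = 0 ↔ m ∈ P := fun m => Ideal.Quotient.eq_zero_iff_mem
  -- `D` collects the partial derivatives that make the relations simple. `G` keeps the coordinates
  -- of the transcendence basis and replaces the others by their relations, so it sends the zeros of
  -- `P` into a coordinate subspace.
  let D : MvPolynomial ι ℝ := ∏ j, aeval (a j) (pderiv none (q j))
  let G : ι → MvPolynomial ι ℝ := fun j =>
    if j ∈ Set.range s then X j else aeval (a j) (q j)
  refine ⟨Set.range s, D, ?_, ?_, ?_⟩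
  · have h1 : AlgebraicIndependent ℝ (Subtype.val : T → MvPolynomial ι ℝ ⧸ P) := hT.1
    have h2 := h1.comp (fun b : Set.range s => (Equiv.ofInjective s hsinj).symm b)
      (Equiv.injective _)
    convert h2 using 2 with b
    rw [Function.comp_apply, ← hs]
    simp only [φ]
    rw [Equiv.apply_ofInjective_symm hsinj]
  · rw [← hmem, map_prod]
    exact Finset.prod_ne_zero_iff.2 fun j _ => by rw [haφ]; exact hq' j
  · have hmaps : Set.MapsTo (fun (y : ι → ℝ) j => eval y (G j))
        (realZeros P ∩ {y | eval y D ≠ 0}) {z : ι → ℝ | ∀ i ∉ Set.range s, z i = 0} := by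
      intro y hy i hi
      simp only [G, if_neg hi]
      exact hy.1 _ ((hmem _).1 ((haφ i _).trans (hq i)))
    have hcard : (Set.range s).ncard = Fintype.card T := by
      rw [Set.ncard_eq_toFinset_card', Set.toFinset_range,
        Finset.card_image_of_injective _ hsinj, Finset.card_univ]
    rw [hcard]
    refine (dimH_le_of_hasStrictFDerivAt hmaps fun y hy => ?_).trans
      (dimH_support_subset_range_le s)
    let G' : (ι → ℝ) →L[ℝ] (ι → ℝ) := ContinuousLinearMap.pi fun j => polyDeriv (G j) y
    have hG' : HasStrictFDerivAt (fun (y : ι → ℝ) j => eval y (G j)) G' y :=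
      hasStrictFDerivAt_pi.2 fun j => hasStrictFDerivAt_eval (G j) y
    have hDy : ∀ j, eval y (aeval (a j) (pderiv none (q j))) ≠ 0 := by
      intro j
      have := hy.2
      simp only [D, Set.mem_ofPred_eq, map_prod] at this
      exact Finset.prod_ne_zero_iff.1 this j (Finset.mem_univ j)
    -- The Jacobian is triangular: a kernel vector vanishes on the basis coordinates, and each
    -- remaining row then reads as a nonzero factor of `D` times one entry.
    have hker : LinearMap.ker (G' : (ι → ℝ) →ₗ[ℝ] (ι → ℝ)) = ⊥ := by
      rw [LinearMap.ker_eq_bot']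
      intro v hv
      have hv' : ∀ j, polyDeriv (G j) y v = 0 := fun j => congrFun hv j
      have hB : ∀ j ∈ Set.range s, v j = 0 := by
        intro j hj
        have := hv' j
        simp only [G, if_pos hj, polyDeriv_X] at this
        exact this
      funext j
      by_cases hj : j ∈ Set.range s
      · exact hB j hj
      · have h := hv' j
        simp only [G, if_neg hj] at h
        rw [polyDeriv_aeval, Fintype.sum_option] at h
        simp only [a, Option.elim_none, Option.elim_some, polyDeriv_X, add_apply, sum_apply,
          smul_apply, ContinuousLinearMap.proj_apply, smul_eq_mul, hB _ (Set.mem_range_self _),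
          mul_zero, Finset.sum_const_zero, add_zero] at h
        exact (mul_eq_zero.1 h).resolve_left (hDy j)
    let e : (ι → ℝ) ≃L[ℝ] (ι → ℝ) := (LinearEquiv.ofInjectiveEndo
      (G' : (ι → ℝ) →ₗ[ℝ] (ι → ℝ)) (LinearMap.ker_eq_bot.1 hker)).toContinuousLinearEquiv
    refine ⟨e, ?_⟩
    have : (e : (ι → ℝ) →L[ℝ] (ι → ℝ)) = G' := by ext v; rfl
    rw [this]
    exact hG'

open MvPolynomial in
/-- The dimension of the set of real zeros of a prime ideal is at most its transcendence degree. -/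
theorem dimH_realZeros_le [Fintype ι] (P : Ideal (MvPolynomial ι ℝ)) [hP : P.IsPrime] {k : ℕ}
    (hk : ∀ B : Set ι,
      AlgebraicIndependent ℝ (fun b : B => Ideal.Quotient.mkₐ ℝ P (X (b : ι))) → B.ncard ≤ k) :
    dimH (realZeros P) ≤ k := by
  suffices h : ∀ P : Ideal (MvPolynomial ι ℝ), P.IsPrime →
      (∀ B : Set ι, AlgebraicIndependent ℝ (fun b : B => Ideal.Quotient.mkₐ ℝ P (X (b : ι))) →
        B.ncard ≤ k) → dimH (realZeros P) ≤ k from h P hP hk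
  clear! P
  intro P
  induction P using IsNoetherian.induction with
  | hgt P ih =>
  intro hP hk
  obtain ⟨B, D, hB, hD, hdim⟩ := exists_dimH_realZeros_inter_le P
  -- The zeros of `P` missed by the generic bound lie on finitely many primes minimal over `P` and
  -- `D`. Each strictly contains `P`, so Noetherian induction applies.
  have hcover : realZeros P ⊆ (realZeros P ∩ {y | eval y D ≠ 0}) ∪
      ⋃ Q ∈ Ideal.minimalPrimes (P ⊔ Ideal.span {D}), realZeros Q := by
    intro y hy
    by_cases hyD : eval y D = 0
    · refine Or.inr (realZeros_subset_biUnion_minimalPrimes _ fun m hm => ?_)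
      have : P ⊔ Ideal.span {D} ≤ RingHom.ker (eval y) :=
        sup_le (fun m hm => hy m hm) ((Ideal.span_singleton_le_iff_mem _).2 hyD)
      exact this hm
    · exact Or.inl ⟨hy, hyD⟩
  refine (dimH_mono hcover).trans ?_
  rw [dimH_union, dimH_bUnion (Ideal.finite_minimalPrimes_of_isNoetherianRing _ _).countable]
  refine max_le (hdim.trans (by exact_mod_cast hk B hB)) (iSup₂_le fun Q hQ => ?_)
  have hPQ : P ⊔ Ideal.span {D} ≤ Q := hQ.1.2
  have hle : P ≤ Q := le_sup_left.trans hPQ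
  have hDQ : D ∈ Q := hPQ (Ideal.mem_sup_right (Ideal.mem_span_singleton_self D))
  have hQp : Q.IsPrime := hQ.1.1
  refine ih Q (lt_of_le_of_ne hle fun h => hD (h ▸ hDQ)) hQp fun C hC => hk C ?_
  exact AlgebraicIndependent.of_comp (Ideal.Quotient.factorₐ ℝ hle) hC

open MvPolynomial in
/-- The dimension of the image of a polynomial map is at most the transcendence degree of its
components. -/
theorem dimH_range_eval_le [Fintype ι] {σ : Type*} (F : ι → MvPolynomial σ ℝ) {k : ℕ}
    (hk : ∀ B : Set ι, AlgebraicIndependent ℝ (fun b : B => F b) → B.ncard ≤ k) :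
    dimH (Set.range fun (x : σ → ℝ) i => eval x (F i)) ≤ k := by
  -- The algebraic relations among the `F i` form a prime ideal vanishing on the image; coordinates
  -- independent modulo it correspond to independent components of `F`.
  let P := RingHom.ker (aeval F : MvPolynomial ι ℝ →ₐ[ℝ] MvPolynomial σ ℝ)
  have hP : P.IsPrime := RingHom.ker_isPrime _
  refine (dimH_mono ?_).trans (dimH_realZeros_le P fun B hB => hk B ?_)
  · rintro _ ⟨x, rfl⟩ m hm
    have : (aeval x : MvPolynomial σ ℝ →ₐ[ℝ] ℝ).comp (aeval F) =
        aeval (fun i => eval x (F i)) := by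
      ext t; simp [aeval_eq_eval]
    have h2 := DFunLike.congr_fun this m
    rw [AlgHom.comp_apply, show aeval F m = 0 from hm, map_zero] at h2
    simpa [aeval_eq_eval] using h2.symm
  · rw [algebraicIndependent_iff] at hB ⊢
    intro m hm
    refine hB m ?_
    have h1 : aeval (fun b : B => Ideal.Quotient.mkₐ ℝ P (X (b : ι))) m =
        Ideal.Quotient.mkₐ ℝ P (rename Subtype.val m) := by
      have : aeval (fun b : B => Ideal.Quotient.mkₐ ℝ P (X (b : ι))) =
          (Ideal.Quotient.mkₐ ℝ P).comp (rename (Subtype.val : B → ι)) := by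
        ext b; simp
      rw [this]; rfl
    rw [h1]
    refine Ideal.Quotient.eq_zero_iff_mem.2 ?_
    change aeval F (rename Subtype.val m) = 0
    rw [aeval_rename]
    exact hm

end AlgebraicSets

end LpRigidity

namespace LpRigidity

/-! ### Linear algebra of functionals. -/

section Functionals

/-- Linearly independent functionals are jointly surjective. -/
theorem range_pi_eq_top {E κ : Type*} [NormedAddCommGroup E] [NormedSpace ℝ E] [Fintype κ]
    {l : κ → E →L[ℝ] ℝ} (hl : LinearIndependent ℝ l) :
    (ContinuousLinearMap.pi l).range = ⊤ := by
  classical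
  by_contra hne
  obtain ⟨φ, hφ, hmap⟩ := Submodule.exists_dual_map_eq_bot_of_lt_top
    (lt_top_iff_ne_top.2 hne) inferInstance
  refine hφ ?_
  have hsum : ∑ i, φ (Pi.single i 1) • l i = 0 := by
    ext v
    have h : φ (fun i => l i v) = 0 := by
      have : φ (fun i => l i v) ∈ (⊥ : Submodule ℝ ℝ) :=
        hmap ▸ Submodule.mem_map_of_mem ⟨v, rfl⟩
      simpa using this
    rw [pi_eq_sum_univ' (fun i => l i v), map_sum] at h
    simp only [map_smul, smul_eq_mul] at h
    simp only [sum_apply, smul_apply, smul_eq_mul, zero_apply]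
    rw [← h]
    exact Finset.sum_congr rfl fun i _ => by rw [mul_comm]
  have hz := Fintype.linearIndependent_iff.1 hl _ hsum
  refine LinearMap.pi_ext' fun i => LinearMap.ext_ring ?_
  simpa using hz i

/-- Used to pass between the differentials of lengths and those of their `p`-th powers. -/
theorem linearIndependent_smul_of_ne_zero {K M κ : Type*} [Field K] [AddCommGroup M] [Module K M]
    {c : κ → K} (hc : ∀ i, c i ≠ 0) {l : κ → M} :
    LinearIndependent K (fun i => c i • l i) ↔ LinearIndependent K l :=
  LinearIndependent.units_smul_iff l fun i => Units.mk0 (c i) (hc i)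

theorem dimension_eq_dimH {ι : Type*} [h : Fintype ι] (S : Set (ι → ℝ)) :
    dimension S = dimH S := by
  have : Fintype.ofFinite ι = h := Subsingleton.elim _ _
  unfold dimension
  rw [this]

end Functionals

/-! ### Coordinates of configurations and rows of the rigidity matrix. -/

section Coordinates

variable {V : Type*} {p d : ℕ} [hp : Fact (1 ≤ (p : ℝ≥0∞))]

theorem one_le_exponent (p : ℕ) [hp : Fact (1 ≤ (p : ℝ≥0∞))] : 1 ≤ p := by
  exact_mod_cast hp.out

theorem pairLength_mk (r : V → LpSpace p d) (v w : V) :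
    pairLength r s(v, w) = dist (r v) (r w) := rfl

theorem pairLength_nonneg (r : V → LpSpace p d) (e : Sym2 V) : 0 ≤ pairLength r e := by
  induction e with
  | _ v w => exact dist_nonneg (x := r v) (y := r w)

theorem pairLength_pow (r : V → LpSpace p d) (v w : V) :
    pairLength r s(v, w) ^ p = ∑ i, |r v i - r w i| ^ p := by
  have h1 := one_le_exponent p
  have hp0 : 0 < (p : ℝ≥0∞).toReal := by
    rw [ENNReal.toReal_natCast]; exact_mod_cast h1
  rw [pairLength_mk, PiLp.dist_eq_sum hp0]
  simp only [ENNReal.toReal_natCast, Real.rpow_natCast, one_div, Real.dist_eq]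
  exact Real.rpow_inv_natCast_pow (Finset.sum_nonneg fun i _ => by positivity) (by omega)

variable (V p d) in
/-- The coordinates of a configuration. -/
noncomputable def coordEquiv [Fintype V] : (V → LpSpace p d) ≃L[ℝ] (V × Fin d → ℝ) :=
  LinearEquiv.toContinuousLinearEquiv
    { toFun := fun r c => r c.1 c.2
      invFun := fun x v => WithLp.toLp _ fun i => x (v, i)
      map_add' := fun _ _ => rfl
      map_smul' := fun _ _ => rfl
      left_inv := fun _ => rfl
      right_inv := fun _ => rfl }

variable [Fintype V]

theorem coordEquiv_apply (r : V → LpSpace p d) (c : V × Fin d) :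
    coordEquiv V p d r c = r c.1 c.2 := rfl

theorem coordEquiv_symm_apply (x : V × Fin d → ℝ) (v : V) (i : Fin d) :
    (coordEquiv V p d).symm x v i = x (v, i) := rfl

/-- The coordinate difference as a functional on configurations. -/
noncomputable def coordDiff (v w : V) (i : Fin d) : (V → LpSpace p d) →L[ℝ] ℝ :=
  ((ContinuousLinearMap.proj (v, i) : (V × Fin d → ℝ) →L[ℝ] ℝ) -
    ContinuousLinearMap.proj (w, i)).comp
      (coordEquiv V p d : (V → LpSpace p d) →L[ℝ] (V × Fin d → ℝ))

open Classical in
/-- The coefficients of a functional on configurations in the coordinates. -/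
noncomputable def functionalCoeffs :
    ((V → LpSpace p d) →L[ℝ] ℝ) →ₗ[ℝ] (V × Fin d → ℝ) where
  toFun l c := l ((coordEquiv V p d).symm (Pi.single c 1))
  map_add' _ _ := rfl
  map_smul' _ _ := rfl

theorem functionalCoeffs_injective :
    Function.Injective (functionalCoeffs : ((V → LpSpace p d) →L[ℝ] ℝ) →ₗ[ℝ] _) := by
  classical
  rw [← LinearMap.ker_eq_bot, LinearMap.ker_eq_bot']
  intro l hl
  ext r
  have h : ∀ c, l ((coordEquiv V p d).symm (Pi.single c 1)) = 0 := fun c => congrFun hl c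
  rw [← (coordEquiv V p d).symm_apply_apply r, pi_eq_sum_univ' (coordEquiv V p d r), map_sum,
    map_sum]
  refine Finset.sum_eq_zero fun c _ => ?_
  rw [map_smul, map_smul, smul_eq_zero]
  right
  convert h c

theorem rigidityMatrix_row (G : SimpleGraph V) (r : V → LpSpace p d) (e : G.edgeSet) :
    (rigidityMatrix G r).row e =
      functionalCoeffs (fderiv ℝ (fun s : V → LpSpace p d => pairLength s (e : Sym2 V)) r) := by
  classical
  funext c
  change fderiv ℝ (fun s : V → LpSpace p d => pairLength s (e : Sym2 V)) r _ =
    fderiv ℝ (fun s : V → LpSpace p d => pairLength s (e : Sym2 V)) r _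
  congr 1
  refine (coordEquiv V p d).injective ?_
  rw [ContinuousLinearEquiv.apply_symm_apply]
  funext c'
  rw [coordEquiv_apply]
  obtain ⟨v, i⟩ := c
  obtain ⟨w, j⟩ := c'
  by_cases hv : w = v
  · subst hv
    by_cases hi : j = i
    · subst hi; simp
    · simp [hi]
  · simp [hv]

/-- A row lists the coefficients of a differential, and taking coefficients is linear and injective.
-/
theorem linearIndependent_rows_iff {κ : Type*} (G : SimpleGraph V) (r : V → LpSpace p d)
    (a : κ → G.edgeSet) :
    LinearIndependent ℝ (fun i => (rigidityMatrix G r).row (a i)) ↔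
      LinearIndependent ℝ fun i =>
        fderiv ℝ (fun s : V → LpSpace p d => pairLength s (a i : Sym2 V)) r := by
  simp only [rigidityMatrix_row]
  exact LinearMap.linearIndependent_iff _ (LinearMap.ker_eq_bot.2 functionalCoeffs_injective)

theorem card_le_rank {κ : Type*} [Fintype κ] {G : SimpleGraph V} {r : V → LpSpace p d}
    {a : κ → G.edgeSet}
    (h : LinearIndependent ℝ (fun i => (rigidityMatrix G r).row (a i))) :
    Fintype.card κ ≤ (rigidityMatrix G r).rank := by
  rw [Matrix.rank_eq_finrank_span_row, ← finrank_span_eq_card h]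
  exact Submodule.finrank_mono (Submodule.span_mono (by rintro _ ⟨i, rfl⟩; exact ⟨a i, rfl⟩))

/-- There are as many linearly independent rows of the rigidity matrix as its rank. -/
theorem exists_independent_rows (G : SimpleGraph V) (r : V → LpSpace p d) :
    ∃ S : Set G.edgeSet, S.ncard = (rigidityMatrix G r).rank ∧
      LinearIndependent ℝ (fun e : S => (rigidityMatrix G r).row e) := by
  obtain ⟨κ, a, ha, hspan, hli⟩ := exists_linearIndependent' ℝ (rigidityMatrix G r).row
  have : Finite κ := Finite.of_injective a ha
  have : Fintype κ := Fintype.ofFinite κ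
  refine ⟨Set.range a, ?_, ?_⟩
  · rw [Matrix.rank_eq_finrank_span_row, ← hspan, finrank_span_eq_card hli,
      ← Nat.card_coe_set_eq, Nat.card_congr (Equiv.ofInjective a ha).symm,
      Nat.card_eq_fintype_card]
  · rw [← linearIndependent_equiv (Equiv.ofInjective a ha)]
    exact hli

end Coordinates

/-! ### Differentiability of lengths and of their powers. -/

section Differentiability

variable {V : Type*} {p d : ℕ} [hp : Fact (1 ≤ (p : ℝ≥0∞))] [Fintype V]

theorem hasFDerivAt_pairLength_pow {r : V → LpSpace p d} {e : Sym2 V}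
    (h : DifferentiableAt ℝ (fun s : V → LpSpace p d => pairLength s e) r) :
    HasFDerivAt (fun s : V → LpSpace p d => pairLength s e ^ p)
      ((p * pairLength r e ^ (p - 1)) •
        fderiv ℝ (fun s : V → LpSpace p d => pairLength s e) r) r := by
  simpa using h.hasFDerivAt.pow p

/-- A zero length is a minimum. Hence an edge with nonzero differential has positive length. -/
theorem fderiv_pairLength_eq_zero {r : V → LpSpace p d} {e : Sym2 V} (h : pairLength r e = 0) :
    fderiv ℝ (fun s : V → LpSpace p d => pairLength s e) r = 0 :=
  IsLocalMin.fderiv_eq_zero (Filter.Eventually.of_forall fun s => by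
    simpa only [h] using pairLength_nonneg s e)

theorem contDiff_abs_pow {n : ℕ} (hn : 2 ≤ n) : ContDiff ℝ 1 fun x : ℝ => |x| ^ n := by
  have : (1 : ℝ) < (n : ℝ) := by exact_mod_cast hn
  simpa using contDiff_norm_rpow (E := ℝ) this

/-- At a well-positioned configuration for the `l_1` norm, the ends of an edge differ in every
coordinate. -/
theorem coord_ne_of_differentiableAt (hp1 : p = 1) {r : V → LpSpace p d} {v w : V} (hvw : v ≠ w)
    (h : DifferentiableAt ℝ (fun s : V → LpSpace p d => pairLength s s(v, w)) r) (i : Fin d) :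
    r v i - r w i ≠ 0 := by
  classical
  subst hp1
  intro h0
  -- Moving only `v`, in direction `i`, changes the length as `|t|` plus a constant, which is not
  -- differentiable at `0`.
  let b : V → LpSpace 1 d := (coordEquiv V 1 d).symm (Pi.single (v, i) 1)
  have hline : DifferentiableAt ℝ (fun t : ℝ => pairLength (r + t • b) s(v, w)) 0 := by
    have hg : DifferentiableAt ℝ (fun t : ℝ => r + t • b) 0 := by fun_prop
    refine DifferentiableAt.comp (g := fun s : V → LpSpace 1 d => pairLength s s(v, w)) 0 ?_ hg
    simpa using h
  have heq : (fun t : ℝ => pairLength (r + t • b) s(v, w)) =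
      fun t : ℝ => |t| + ∑ j ∈ Finset.univ.erase i, |r v j - r w j| := by
    funext t
    have := pairLength_pow (r + t • b) v w
    simp only [pow_one] at this
    rw [this, ← Finset.add_sum_erase _ _ (Finset.mem_univ i)]
    have hbv : ∀ j, b v j = if j = i then 1 else 0 := by
      intro j
      simp [b, coordEquiv_symm_apply, Pi.single_apply]
    have hbw : ∀ j, b w j = 0 := by
      intro j
      simp [b, coordEquiv_symm_apply, hvw.symm]
    congr 1
    · simp only [Pi.add_apply, Pi.smul_apply, PiLp.add_apply, PiLp.smul_apply, hbv, hbw,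
        if_true, smul_eq_mul, mul_one, mul_zero, add_zero]
      rw [show r v i + t - r w i = t + (r v i - r w i) by ring, h0, add_zero]
    · refine Finset.sum_congr rfl fun j hj => ?_
      simp [hbv, hbw, Finset.ne_of_mem_erase hj]
  rw [heq] at hline
  refine not_differentiableAt_abs_zero ?_
  simpa using hline.sub_const (∑ j ∈ Finset.univ.erase i, |r v j - r w j|)

/-- The submersion argument needs strict differentiability, and well-positionedness gives only
differentiability. For `p ≥ 2` the power is `C^1` everywhere; for `p = 1` the coordinate differences
are nonzero, so the absolute values are smooth there. -/
theorem hasStrictFDerivAt_pairLength_pow {r : V → LpSpace p d} {e : Sym2 V} (he : ¬ e.IsDiag)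
    (h : DifferentiableAt ℝ (fun s : V → LpSpace p d => pairLength s e) r) :
    HasStrictFDerivAt (fun s : V → LpSpace p d => pairLength s e ^ p)
      ((p * pairLength r e ^ (p - 1)) •
        fderiv ℝ (fun s : V → LpSpace p d => pairLength s e) r) r := by
  suffices hs : ∃ f', HasStrictFDerivAt (fun s : V → LpSpace p d => pairLength s e ^ p) f' r by
    obtain ⟨f', hf'⟩ := hs
    rwa [(hasFDerivAt_pairLength_pow h).unique hf'.hasFDerivAt]
  induction e with
  | _ v w =>
  have hvw : v ≠ w := by simpa using he
  have heq : (fun s : V → LpSpace p d => pairLength s s(v, w) ^ p) =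
      fun s => ∑ i, |coordDiff v w i s| ^ p := by
    funext s; exact pairLength_pow s v w
  rw [heq]
  have hcd : ContDiffAt ℝ 1 (fun s : V → LpSpace p d => ∑ i, |coordDiff v w i s| ^ p) r := by
    refine ContDiffAt.sum fun i _ => ?_
    rcases (one_le_exponent p).lt_or_eq with h2 | h1
    · exact ((contDiff_abs_pow h2).comp (coordDiff (p := p) v w i).contDiff).contDiffAt
    · have hne := coord_ne_of_differentiableAt h1.symm hvw h i
      exact ((contDiffAt_abs hne).comp r (coordDiff (p := p) v w i).contDiff.contDiffAt).pow p
  exact ⟨_, hcd.hasStrictFDerivAt one_ne_zero⟩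

end Differentiability

/-! ### Rank bounds dimension from below. -/

section LowerBound

variable {V : Type*} {p d : ℕ} [hp : Fact (1 ≤ (p : ℝ≥0∞))] [Fintype V]

/-- The rank of the rigidity matrix of a well-positioned framework is at most the dimension of the
projected stratum. -/
theorem rank_le_dimension {G : SimpleGraph V} {r : V → LpSpace p d} (hr : IsWellPositioned G r) :
    ((rigidityMatrix G r).rank : ℝ≥0∞) ≤ dimension (projStratum p d G) := by
  classical
  have : Fintype G.edgeSet := Fintype.ofFinite _
  obtain ⟨S, hcard, hli⟩ := exists_independent_rows G r
  rw [linearIndependent_rows_iff G r (fun e : S => (e : G.edgeSet))] at hli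
  have hne : ∀ e : S, ((p : ℝ) * pairLength r ((e : G.edgeSet) : Sym2 V) ^ (p - 1)) ≠ 0 := by
    intro e
    have h1 : (p : ℝ) ≠ 0 := by
      have := one_le_exponent p
      positivity
    exact mul_ne_zero h1 (pow_ne_zero _ fun h => hli.ne_zero e (fderiv_pairLength_eq_zero h))
  rw [← linearIndependent_smul_of_ne_zero hne] at hli
  have hstrict := hasStrictFDerivAt_pi.2 fun e : S =>
    hasStrictFDerivAt_pairLength_pow (G.not_isDiag_of_mem_edgeSet (e : G.edgeSet).2)
      (hr _ (e : G.edgeSet).2)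
  -- A submersion is locally open, so the measurements on `S` fill a set of full dimension, a
  -- 1-Lipschitz image of the projected stratum.
  have hmap := hstrict.map_nhds_eq_of_surj (range_pi_eq_top hli)
  have hnhds : (fun (δ : G.edgeSet → ℝ) (e : S) => δ e) '' projStratum p d G ∈
      nhds (fun e : S => pairLength r ((e : G.edgeSet) : Sym2 V) ^ p) := by
    rw [← hmap, Filter.mem_map]
    refine Filter.Eventually.of_forall fun s => ?_
    exact ⟨_, ⟨_, ⟨s, rfl⟩, rfl⟩, rfl⟩
  have hdim := Real.dimH_of_mem_nhds hnhds
  rw [Module.finrank_fintype_fun_eq_card] at hdim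
  have hlip : LipschitzWith 1 fun (δ : G.edgeSet → ℝ) (e : S) => δ e :=
    LipschitzWith.of_dist_le_mul fun x y => by
      simpa using (dist_pi_le_iff dist_nonneg).2 fun e : S => dist_le_pi_dist x y e
  rw [dimension_eq_dimH, ← hcard, ← Nat.card_coe_set_eq, Nat.card_eq_fintype_card, ← hdim]
  exact hlip.dimH_image_le _

end LowerBound

end LpRigidity

namespace LpRigidity

theorem projStratum_top {V : Type*} {p d : ℕ} [Fact (1 ≤ (p : ℝ≥0∞))] :
    projStratum p d (⊤ : SimpleGraph V) = stratum V p d :=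
  Set.image_id (stratum V p d)

/-- Every configuration has its coordinates weakly ordered by some system of linear orders. -/
theorem exists_monotone_order {V : Type*} [Fintype V] {p d : ℕ} (r : V → LpSpace p d) :
    ∃ g : Fin d → V ≃ Fin (Fintype.card V), ∀ i v w, g i v ≤ g i w → r v i ≤ r w i := by
  let e := Fintype.equivFin V
  let f : Fin d → Fin (Fintype.card V) → ℝ := fun i j => r (e.symm j) i
  refine ⟨fun i => e.trans (Tuple.sort (f i)).symm, fun i v w h => ?_⟩
  have := Tuple.monotone_sort (f i) h
  simpa [f] using this

/-! ### Order chambers and the upper bound on dimension. -/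

section Chambers

variable {V : Type*} {p d : ℕ} [hp : Fact (1 ≤ (p : ℝ≥0∞))] [Fintype V]

/-- Points of the coordinate space all of whose coordinate differences have the strict sign
prescribed by one linear order of `V` for each direction. -/
def openChamber (g : Fin d → V ≃ Fin (Fintype.card V)) : Set (V × Fin d → ℝ) :=
  {x | ∀ i v w, g i v < g i w → x (v, i) < x (w, i)}

theorem isOpen_openChamber (g : Fin d → V ≃ Fin (Fintype.card V)) : IsOpen (openChamber g) := by
  have : openChamber g = ⋂ i, ⋂ v, ⋂ w, {x | g i v < g i w → x (v, i) < x (w, i)} := by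
    ext x; simp [openChamber]
  rw [this]
  refine isOpen_iInter_of_finite fun i => isOpen_iInter_of_finite fun v =>
    isOpen_iInter_of_finite fun w => ?_
  by_cases h : g i v < g i w
  · simp only [h, true_imp_iff]
    exact isOpen_lt (continuous_apply _) (continuous_apply _)
  · simp [h]

theorem openChamber_nonempty (g : Fin d → V ≃ Fin (Fintype.card V)) :
    (openChamber g).Nonempty :=
  ⟨fun c => (g c.2 c.1 : ℕ), fun _ _ _ h => Nat.cast_lt.2 h⟩

/-- The polynomial that computes the `p`-th power of the length of a pair in one chamber. -/
noncomputable def chamberPoly (p : ℕ) (g : Fin d → V ≃ Fin (Fintype.card V)) (e : Sym2 V) :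
    MvPolynomial (V × Fin d) ℝ :=
  ∑ i, (MvPolynomial.C (if g i e.out.2 ≤ g i e.out.1 then 1 else -1) *
    (MvPolynomial.X (e.out.1, i) - MvPolynomial.X (e.out.2, i))) ^ p

/-- Only weak inequalities are required: the closed chambers cover all configurations, while
differentials are studied in the open ones. -/
theorem eval_chamberPoly {g : Fin d → V ≃ Fin (Fintype.card V)} {r : V → LpSpace p d}
    (hr : ∀ i v w, g i v ≤ g i w → r v i ≤ r w i) (e : Sym2 V) :
    MvPolynomial.eval (coordEquiv V p d r) (chamberPoly p g e) = pairLength r e ^ p := by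
  have he : e = s(e.out.1, e.out.2) := e.out_eq.symm
  conv_rhs => rw [he, pairLength_pow]
  rw [chamberPoly, map_sum]
  refine Finset.sum_congr rfl fun i _ => ?_
  simp only [map_pow, map_mul, MvPolynomial.eval_C, map_sub, MvPolynomial.eval_X,
    coordEquiv_apply]
  congr 1
  split_ifs with h
  · rw [one_mul, abs_of_nonneg (sub_nonneg.2 (hr _ _ _ h))]
  · rw [neg_one_mul, abs_of_nonpos (sub_nonpos.2 (hr _ _ _ (le_of_not_ge h)))]

theorem le_of_mem_openChamber {g : Fin d → V ≃ Fin (Fintype.card V)} {x : V × Fin d → ℝ}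
    (hx : x ∈ openChamber g) (i : Fin d) (v w : V) (h : g i v ≤ g i w) : x (v, i) ≤ x (w, i) := by
  rcases h.lt_or_eq with h | h
  · exact (hx i v w h).le
  · rw [(g i).injective h]

theorem hasFDerivAt_pow_of_mem_openChamber {g : Fin d → V ≃ Fin (Fintype.card V)}
    {r : V → LpSpace p d} (hr : coordEquiv V p d r ∈ openChamber g) (e : Sym2 V) :
    HasFDerivAt (fun s : V → LpSpace p d => pairLength s e ^ p)
      ((polyDeriv (chamberPoly p g e) (coordEquiv V p d r)).comp
        (coordEquiv V p d : (V → LpSpace p d) →L[ℝ] (V × Fin d → ℝ))) r := by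
  have h1 := (hasStrictFDerivAt_eval (chamberPoly p g e) (coordEquiv V p d r)).hasFDerivAt.comp r
    (coordEquiv V p d).hasFDerivAt
  refine h1.congr_of_eventuallyEq ?_
  filter_upwards [(coordEquiv V p d).continuous.continuousAt.preimage_mem_nhds
    ((isOpen_openChamber g).mem_nhds hr)] with s hs
  exact (eval_chamberPoly (fun i v w h => le_of_mem_openChamber hs i v w h) e).symm

/-- A nonzero length is locally the `p`-th root of a nonvanishing polynomial. Distinct vertices can
coincide only if `d = 0`, and then there is a single configuration. -/
theorem isWellPositioned_of_mem_openChamber {g : Fin d → V ≃ Fin (Fintype.card V)}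
    {r : V → LpSpace p d} (hr : coordEquiv V p d r ∈ openChamber g) (G : SimpleGraph V) :
    IsWellPositioned G r := by
  intro e he
  have hp0 : p ≠ 0 := Nat.one_le_iff_ne_zero.1 (one_le_exponent p)
  by_cases h0 : pairLength r e = 0
  · induction e with
    | _ v w =>
    have hvw : v ≠ w := G.ne_of_adj he
    have hrvw : r v = r w := dist_eq_zero.1 h0
    have hd : IsEmpty (Fin d) := by
      refine ⟨fun i => ?_⟩
      have hne : g i v ≠ g i w := fun h => hvw ((g i).injective h)
      have heq : r v i = r w i := by rw [hrvw]
      rcases hne.lt_or_gt with h | h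
      · exact (hr i v w h).ne heq
      · exact (hr i w v h).ne heq.symm
    have hsub : Subsingleton (V → LpSpace p d) :=
      ⟨fun a b => (coordEquiv V p d).injective (funext fun c => isEmptyElim c.2)⟩
    have : (fun s : V → LpSpace p d => pairLength s s(v, w)) = fun _ => pairLength r s(v, w) :=
      funext fun s => by rw [Subsingleton.elim s r]
    rw [this]
    exact differentiableAt_const _
  · have h := (hasFDerivAt_pow_of_mem_openChamber hr e).differentiableAt.rpow_const
      (p := (p : ℝ)⁻¹) (Or.inl (pow_ne_zero _ h0))
    refine h.congr_of_eventuallyEq (Filter.Eventually.of_forall fun s => ?_)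
    exact (Real.pow_rpow_inv_natCast (pairLength_nonneg s e) hp0).symm

/-- In every chamber there is a framework whose rank is at least the number of any given set of
edges with algebraically independent chamber polynomials. -/
theorem exists_ncard_le_rank {G : SimpleGraph V} {g : Fin d → V ≃ Fin (Fintype.card V)}
    {B : Set G.edgeSet}
    (hB : AlgebraicIndependent ℝ fun e : B => chamberPoly p g ((e : G.edgeSet) : Sym2 V)) :
    ∃ r : V → LpSpace p d, IsWellPositioned G r ∧ B.ncard ≤ (rigidityMatrix G r).rank := by
  obtain ⟨x, hx, hli⟩ := exists_linearIndependent_polyDeriv hB (isOpen_openChamber g)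
    (openChamber_nonempty g)
  let r := (coordEquiv V p d).symm x
  have hrx : coordEquiv V p d r = x := (coordEquiv V p d).apply_symm_apply x
  have hr : coordEquiv V p d r ∈ openChamber g := hrx ▸ hx
  have hwp := isWellPositioned_of_mem_openChamber hr G
  refine ⟨r, hwp, ?_⟩
  have : Fintype B := Fintype.ofFinite B
  let T : ((V × Fin d → ℝ) →L[ℝ] ℝ) →ₗ[ℝ] ((V → LpSpace p d) →L[ℝ] ℝ) :=
    { toFun := fun l => l.comp (coordEquiv V p d : (V → LpSpace p d) →L[ℝ] (V × Fin d → ℝ))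
      map_add' := fun _ _ => rfl
      map_smul' := fun _ _ => rfl }
  have hT : LinearMap.ker T = ⊥ := by
    rw [LinearMap.ker_eq_bot']
    intro l hl
    ext y
    have h : l (coordEquiv V p d ((coordEquiv V p d).symm y)) = 0 :=
      DFunLike.congr_fun hl ((coordEquiv V p d).symm y)
    rwa [ContinuousLinearEquiv.apply_symm_apply] at h
  rw [← LinearMap.linearIndependent_iff T hT] at hli
  -- Uniqueness of the derivative identifies the polynomial differentials with multiples of the
  -- length differentials; independence forces the factors to be nonzero.
  have heq : T ∘ (fun e : B => polyDeriv (chamberPoly p g ((e : G.edgeSet) : Sym2 V)) x) =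
      fun e : B => ((p : ℝ) * pairLength r ((e : G.edgeSet) : Sym2 V) ^ (p - 1)) •
        fderiv ℝ (fun s : V → LpSpace p d => pairLength s ((e : G.edgeSet) : Sym2 V)) r := by
    funext e
    have h1 := hasFDerivAt_pow_of_mem_openChamber hr ((e : G.edgeSet) : Sym2 V)
    rw [hrx] at h1
    exact h1.unique (hasFDerivAt_pairLength_pow (hwp _ (e : G.edgeSet).2))
  rw [heq] at hli
  have hne : ∀ e : B, (p : ℝ) * pairLength r ((e : G.edgeSet) : Sym2 V) ^ (p - 1) ≠ 0 :=
    fun e h => hli.ne_zero e (by simp only [h, zero_smul])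
  replace hli := (linearIndependent_smul_of_ne_zero hne).1 hli
  rw [← linearIndependent_rows_iff G r (fun e : B => (e : G.edgeSet))] at hli
  rw [← Nat.card_coe_set_eq, Nat.card_eq_fintype_card]
  exact card_le_rank hli

/-- Each chamber contributes at most the number of algebraically independent chamber polynomials,
and that number is bounded by the rank of some framework. Letting each polynomial map range over the
whole space, not just its chamber, costs nothing. -/
theorem dimension_projStratum_le {G : SimpleGraph V} {k : ℕ}
    (hk : ∀ r : V → LpSpace p d, IsWellPositioned G r → (rigidityMatrix G r).rank ≤ k) :
    dimension (projStratum p d G) ≤ k := by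
  classical
  have : Fintype G.edgeSet := Fintype.ofFinite _
  rw [dimension_eq_dimH]
  have hcover : projStratum p d G ⊆ ⋃ g : Fin d → V ≃ Fin (Fintype.card V),
      Set.range fun (x : V × Fin d → ℝ) (e : G.edgeSet) =>
        MvPolynomial.eval x (chamberPoly p g (e : Sym2 V)) := by
    rintro _ ⟨_, ⟨r, rfl⟩, rfl⟩
    obtain ⟨g, hg⟩ := exists_monotone_order r
    exact Set.mem_iUnion.2 ⟨g, coordEquiv V p d r, funext fun e => eval_chamberPoly hg _⟩
  refine (dimH_mono hcover).trans ?_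
  rw [dimH_iUnion]
  refine iSup_le fun g => dimH_range_eval_le _ fun B hB => ?_
  obtain ⟨r, hr, hle⟩ := exists_ncard_le_rank (p := p) hB
  exact hle.trans (hk r hr)

theorem rank_le_card_edgeSet (G : SimpleGraph V) (r : V → LpSpace p d) :
    (rigidityMatrix G r).rank ≤ Nat.card G.edgeSet := by
  classical
  have : Fintype G.edgeSet := Fintype.ofFinite _
  rw [Nat.card_eq_fintype_card]
  exact Matrix.rank_le_card_height _

variable (p d) in
theorem exists_isRegular (G : SimpleGraph V) : ∃ r : V → LpSpace p d, IsRegular G r := by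
  obtain ⟨x, hx⟩ := openChamber_nonempty fun _ : Fin d => Fintype.equivFin V
  have hne : {k | ∃ r : V → LpSpace p d,
      IsWellPositioned G r ∧ (rigidityMatrix G r).rank = k}.Nonempty :=
    ⟨_, (coordEquiv V p d).symm x, isWellPositioned_of_mem_openChamber
      (by rwa [ContinuousLinearEquiv.apply_symm_apply]) G, rfl⟩
  have hbdd : BddAbove {k | ∃ r : V → LpSpace p d,
      IsWellPositioned G r ∧ (rigidityMatrix G r).rank = k} :=
    ⟨Nat.card G.edgeSet, by rintro _ ⟨r, -, rfl⟩; exact rank_le_card_edgeSet G r⟩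
  obtain ⟨r, hr, hrk⟩ := Nat.sSup_mem hne hbdd
  exact ⟨r, hr, fun s hs => hrk ▸ le_csSup hbdd ⟨s, hs, rfl⟩⟩

/-- The dimension of the projected stratum is the rank of a regular framework. -/
theorem IsRegular.dimension_eq_rank {G : SimpleGraph V} {r : V → LpSpace p d}
    (hr : IsRegular G r) :
    dimension (projStratum p d G) = ((rigidityMatrix G r).rank : ℝ≥0∞) :=
  le_antisymm (dimension_projStratum_le hr.2) (rank_le_dimension hr.1)

end Chambers

/-! ### Graph properties in terms of dimension. -/

section Characterizations

variable {V : Type*} (p d : ℕ) [hp : Fact (1 ≤ (p : ℝ≥0∞))] [Fintype V]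

theorem dimension_projStratum_mono {H G : SimpleGraph V} (h : H ≤ G) :
    dimension (projStratum p d H) ≤ dimension (projStratum p d G) := by
  classical
  have : Fintype G.edgeSet := Fintype.ofFinite _
  have : Fintype H.edgeSet := Fintype.ofFinite _
  rw [dimension_eq_dimH, dimension_eq_dimH]
  let ρ : (G.edgeSet → ℝ) → H.edgeSet → ℝ := fun δ e => δ ⟨e, SimpleGraph.edgeSet_mono h e.2⟩
  have hlip : LipschitzWith 1 ρ :=
    LipschitzWith.of_dist_le_mul fun x y => by
      simpa using (dist_pi_le_iff dist_nonneg).2 fun e : H.edgeSet =>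
        dist_le_pi_dist x y ⟨e, SimpleGraph.edgeSet_mono h e.2⟩
  have himage : projStratum p d H = ρ '' projStratum p d G := by
    rw [projStratum, projStratum, Set.image_image]
    rfl
  rw [himage]
  exact hlip.dimH_image_le _

theorem dimension_projStratum_le_stratum (G : SimpleGraph V) :
    dimension (projStratum p d G) ≤ dimension (stratum V p d) := by
  rw [← projStratum_top]
  exact dimension_projStratum_mono p d le_top

theorem dimension_projStratum_le_card (G : SimpleGraph V) :
    dimension (projStratum p d G) ≤ (Nat.card G.edgeSet : ℝ≥0∞) :=
  dimension_projStratum_le fun r _ => rank_le_card_edgeSet G r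

theorem isIndependent_iff (G : SimpleGraph V) :
    IsIndependent p d G ↔ dimension (projStratum p d G) = (Nat.card G.edgeSet : ℝ≥0∞) := by
  classical
  have : Fintype G.edgeSet := Fintype.ofFinite _
  have hrank : ∀ r : V → LpSpace p d, LinearIndependent ℝ (rigidityMatrix G r).row ↔
      (rigidityMatrix G r).rank = Nat.card G.edgeSet := by
    intro r
    rw [linearIndependent_iff_card_eq_finrank_span, Matrix.rank_eq_finrank_span_row,
      Nat.card_eq_fintype_card, Set.finrank, eq_comm]
  constructor
  · rintro ⟨r, hr, hli⟩
    rw [hr.dimension_eq_rank, (hrank r).1 hli]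
  · intro h
    obtain ⟨r, hr⟩ := exists_isRegular p d G
    rw [hr.dimension_eq_rank] at h
    exact ⟨r, hr, (hrank r).2 (by exact_mod_cast h)⟩

/-- The complete graph attains the dimension of the stratum as a rank, and no graph on `V` exceeds
it. -/
theorem isRigid_iff (G : SimpleGraph V) :
    IsRigid p d G ↔ dimension (projStratum p d G) = dimension (stratum V p d) := by
  constructor
  · rintro ⟨r, hr, hmax⟩
    refine le_antisymm (dimension_projStratum_le_stratum p d G) ?_
    rw [hr.dimension_eq_rank, ← projStratum_top]
    exact dimension_projStratum_le fun s hs => hmax _ s hs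
  · intro h
    obtain ⟨r, hr⟩ := exists_isRegular p d G
    refine ⟨r, hr, fun H s hs => ?_⟩
    have h1 := (rank_le_dimension hs).trans (dimension_projStratum_le_stratum p d H)
    rw [← h, hr.dimension_eq_rank] at h1
    exact_mod_cast h1

/-- Every graph has an independent subgraph whose projected stratum has the same dimension. -/
theorem exists_independent_subgraph (G : SimpleGraph V) :
    ∃ H ≤ G, dimension (projStratum p d H) = (Nat.card H.edgeSet : ℝ≥0∞) ∧
      dimension (projStratum p d H) = dimension (projStratum p d G) := by
  classical
  obtain ⟨r, hr⟩ := exists_isRegular p d G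
  obtain ⟨S, hcard, hli⟩ := exists_independent_rows G r
  rw [linearIndependent_rows_iff G r (fun e : S => (e : G.edgeSet))] at hli
  -- The edges of a maximal independent set of rows at a regular framework; the same `r` certifies
  -- that `H` is independent.
  let H : SimpleGraph V := SimpleGraph.fromEdgeSet (Subtype.val '' S)
  have hHS : H.edgeSet = Subtype.val '' S := by
    rw [SimpleGraph.edgeSet_fromEdgeSet, sdiff_eq_left, Set.disjoint_left]
    rintro _ ⟨e, -, rfl⟩
    exact G.not_isDiag_of_mem_edgeSet e.2
  have hle : H ≤ G := by
    rw [← SimpleGraph.edgeSet_subset_edgeSet, hHS]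
    rintro _ ⟨e, -, rfl⟩
    exact e.2
  have hcardH : Nat.card H.edgeSet = (rigidityMatrix G r).rank := by
    rw [← hcard, hHS, Nat.card_coe_set_eq, Set.ncard_image_of_injective _ Subtype.val_injective]
  have hwp : IsWellPositioned H r := fun e he => hr.1 e (SimpleGraph.edgeSet_mono hle he)
  have hmem : ∀ e : H.edgeSet, ∃ b : S, ((b : G.edgeSet) : Sym2 V) = e := by
    intro e
    have : (e : Sym2 V) ∈ Subtype.val '' S := hHS ▸ e.2
    obtain ⟨b, hb, hbe⟩ := this
    exact ⟨⟨b, hb⟩, hbe⟩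
  choose b hb using hmem
  have hliH : LinearIndependent ℝ fun e : H.edgeSet => (rigidityMatrix H r).row (id e) := by
    rw [linearIndependent_rows_iff]
    have h := hli.comp b fun e e' h => Subtype.ext (by rw [← hb e, ← hb e', h])
    convert h using 2 with e
    simp only [Function.comp_apply, hb, id]
  have : Fintype H.edgeSet := Fintype.ofFinite _
  have hrank := card_le_rank hliH
  rw [← Nat.card_eq_fintype_card] at hrank
  have hge : (Nat.card H.edgeSet : ℝ≥0∞) ≤ dimension (projStratum p d H) :=
    le_trans (by exact_mod_cast hrank) (rank_le_dimension hwp)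
  have heq := le_antisymm (dimension_projStratum_le_card p d H) hge
  exact ⟨H, hle, heq, by rw [heq, hr.dimension_eq_rank, hcardH]⟩

theorem isMaximalIndependent_iff (G : SimpleGraph V) :
    IsMaximalIndependent p d G ↔
      dimension (projStratum p d G) = dimension (stratum V p d) ∧
        dimension (projStratum p d G) = (Nat.card G.edgeSet : ℝ≥0∞) := by
  constructor
  · rintro ⟨hind, hmax⟩
    rw [isIndependent_iff] at hind
    refine ⟨le_antisymm (dimension_projStratum_le_stratum p d G) ?_, hind⟩
    -- An independent graph with as many edges as the dimension of the stratum; maximality of `G`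
    -- bounds that number.
    obtain ⟨H, -, hH, hHtop⟩ := exists_independent_subgraph p d (⊤ : SimpleGraph V)
    rw [← projStratum_top, ← hHtop, hH, hind]
    exact_mod_cast hmax H ((isIndependent_iff p d H).2 hH)
  · rintro ⟨hrig, hind⟩
    refine ⟨(isIndependent_iff p d G).2 hind, fun H hH => ?_⟩
    have h := dimension_projStratum_le_stratum p d H
    rw [(isIndependent_iff p d H).1 hH, ← hrig, hind] at h
    exact_mod_cast h

theorem isMinimallyRigid_iff (G : SimpleGraph V) :
    IsMinimallyRigid p d G ↔
      dimension (projStratum p d G) = dimension (stratum V p d) ∧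
        dimension (projStratum p d G) = (Nat.card G.edgeSet : ℝ≥0∞) := by
  constructor
  · rintro ⟨hrig, hmin⟩
    rw [isRigid_iff] at hrig
    refine ⟨hrig, ?_⟩
    obtain ⟨H, hle, hH, hHG⟩ := exists_independent_subgraph p d G
    rcases hle.eq_or_lt with rfl | hlt
    · exact hH
    · exfalso
      -- Deleting an edge outside `H` leaves a graph containing `H`, hence still of full dimension.
      obtain ⟨e, heG, heH⟩ := Set.exists_of_ssubset (SimpleGraph.edgeSet_ssubset_edgeSet.2 hlt)
      refine hmin e heG ((isRigid_iff p d _).2 ?_)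
      refine le_antisymm (dimension_projStratum_le_stratum p d _) ?_
      rw [← hrig, ← hHG]
      refine dimension_projStratum_mono p d ?_
      rw [← SimpleGraph.edgeSet_subset_edgeSet, SimpleGraph.edgeSet_deleteEdges]
      exact fun f hf => ⟨SimpleGraph.edgeSet_mono hle hf, fun hfe => heH (hfe ▸ hf)⟩
  · rintro ⟨hrig, hind⟩
    refine ⟨(isRigid_iff p d G).2 hrig, fun e he hdel => ?_⟩
    rw [isRigid_iff, ← hrig, hind] at hdel
    have h := dimension_projStratum_le_card p d (G.deleteEdges {e})
    rw [hdel] at h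
    have h' : G.edgeSet.ncard ≤ (G.deleteEdges {e}).edgeSet.ncard := by
      rw [← Nat.card_coe_set_eq, ← Nat.card_coe_set_eq]
      exact_mod_cast h
    rw [SimpleGraph.edgeSet_deleteEdges] at h'
    exact absurd (Set.ncard_sdiff_singleton_lt_of_mem he (Set.toFinite _)) (not_lt.2 h')

end Characterizations

end LpRigidity

theorem mainTheorem3 {V : Type*} [Fintype V] (p d : ℕ) [Fact (1 ≤ (p : ℝ≥0∞))]
    (G : SimpleGraph V) :
    (LpRigidity.IsIndependent p d G ↔
      LpRigidity.dimension (LpRigidity.projStratum p d G) = (Nat.card G.edgeSet : ℝ≥0∞)) ∧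
    (LpRigidity.IsMaximalIndependent p d G ↔
      LpRigidity.dimension (LpRigidity.projStratum p d G) =
          LpRigidity.dimension (LpRigidity.stratum V p d) ∧
        LpRigidity.dimension (LpRigidity.projStratum p d G) = (Nat.card G.edgeSet : ℝ≥0∞)) ∧
    (LpRigidity.IsMinimallyRigid p d G ↔
      LpRigidity.dimension (LpRigidity.projStratum p d G) =
          LpRigidity.dimension (LpRigidity.stratum V p d) ∧
        LpRigidity.dimension (LpRigidity.projStratum p d G) = (Nat.card G.edgeSet : ℝ≥0∞)) ∧
    (LpRigidity.IsRigid p d G ↔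
      LpRigidity.dimension (LpRigidity.projStratum p d G) =
        LpRigidity.dimension (LpRigidity.stratum V p d)) ∧
    (¬ LpRigidity.IsIndependent p d G ∧ ¬ LpRigidity.IsRigid p d G ↔
      LpRigidity.dimension (LpRigidity.projStratum p d G) <
        min (LpRigidity.dimension (LpRigidity.stratum V p d))
          (Nat.card G.edgeSet : ℝ≥0∞)) := by
  refine ⟨LpRigidity.isIndependent_iff p d G, LpRigidity.isMaximalIndependent_iff p d G,
    LpRigidity.isMinimallyRigid_iff p d G, LpRigidity.isRigid_iff p d G, ?_⟩
  -- Both quantities in the minimum bound the dimension from above, so differing from each means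
  -- lying strictly below it.
  rw [LpRigidity.isIndependent_iff, LpRigidity.isRigid_iff, lt_min_iff,
    (LpRigidity.dimension_projStratum_le_stratum p d G).lt_iff_ne,
    (LpRigidity.dimension_projStratum_le_card p d G).lt_iff_ne, and_comm]
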